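/- Let $n\ge 1$ and let $\triangle=\{(x_1,\dots,x_n)\in\mathbb R^n : 1\ge x_1\ge\cdots\ge x_n\ge 0\}$. For each integer $b\ge 0$ put $$\triangle_b=\{x\in\triangle : 1-x_1-b\,x_n\ge 0>1-x_1-(b+1)\,x_n\},$$ and let the triangle map $T$ be given on $\triangle_b$ by $$T(x_1,\dots,x_n)=\Bigl(\frac{x_2}{x_1},\dots,\frac{x_n}{x_1},\frac{1-x_1-b\,x_n}{x_1}\Bigr),\qquad b=\Bigl\lfloor\frac{1-x_1}{x_n}\Bigr\rfloor .$$ A triangle sequence of $x\in\triangle$ is an infinite sequence $(b_0,b_1,\dots)$ of non-negative integers with $T^{k}(x)\in\triangle_{b_k}$ for all $k\ge 0$, and the cylinders of such a sequence are $$\triangle(b_0,\dots,b_m)=\{y : T^{k}(y)\in\triangle_{b_k}\text{ for } 0\le k\le m\}.$$ Then for Lebesgue-almost every $x\in\triangle$ the triangle map converges weakly at $x$: the point $x$ has a triangle sequence $(b_0,b_1,\dots)$, and the nested cylinders $\triangle(b_0,\dots,b_m)$ converge to $\{x\}$ as $m\to\infty$, that is, $\bigcap_{m\ge 0}\triangle(b_0,\dots,b_m)=\{x\}$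 and every neighbourhood of $x$ contains $\triangle(b_0,\dots,b_m)$ for all sufficiently large $m$. -/

import Mathlib

open Set Filter Topology MeasureTheory

namespace TriangleMap

/- The ambient space of dimension `n = d + 1 ≥ 1` is `Fin (d + 1) → ℝ`; the coordinates
`x₁, …, xₙ` are `x 0, …, x (Fin.last d)`. -/

/-- The simplex `△ = {x ∈ ℝⁿ : 1 ≥ x₁ ≥ ⋯ ≥ xₙ ≥ 0}`. -/
def simplex (d : ℕ) : Set (Fin (d + 1) → ℝ) :=
  {x | x 0 ≤ 1 ∧ Antitone x ∧ 0 ≤ x (Fin.last d)}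

/-- The piece `△_b = {x ∈ △ : 1 - x₁ - b xₙ ≥ 0 > 1 - x₁ - (b + 1) xₙ}`. -/
def subsimplex (d : ℕ) (b : ℕ) : Set (Fin (d + 1) → ℝ) :=
  {x | x ∈ simplex d ∧ 0 ≤ 1 - x 0 - (b : ℝ) * x (Fin.last d) ∧
    1 - x 0 - ((b : ℝ) + 1) * x (Fin.last d) < 0}

/-- The digit `b = ⌊(1 - x₁) / xₙ⌋` of a point. It is meaningful on the union of the pieces `△_b`,
that is, on the points of `△` with `xₙ > 0`. -/
noncomputable def digit (d : ℕ) (x : Fin (d + 1) → ℝ) : ℕ :=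
  ⌊(1 - x 0) / x (Fin.last d)⌋₊

/-- The triangle map
`T (x₁, …, xₙ) = (x₂ / x₁, …, xₙ / x₁, (1 - x₁ - b xₙ) / x₁)` for `x ∈ △_b`. -/
noncomputable def triangleMap (d : ℕ) (x : Fin (d + 1) → ℝ) : Fin (d + 1) → ℝ :=
  Fin.snoc (α := fun _ => ℝ) (fun i : Fin d => x i.succ / x 0)
    ((1 - x 0 - (digit d x : ℝ) * x (Fin.last d)) / x 0)

/-- `b` is the triangle sequence of `x`: `x ∈ △_{b₀}`, `T x ∈ △_{b₁}`, `T² x ∈ △_{b₂}`, …. -/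
def IsTriangleSequence (d : ℕ) (x : Fin (d + 1) → ℝ) (b : ℕ → ℕ) : Prop :=
  ∀ k : ℕ, (triangleMap d)^[k] x ∈ subsimplex d (b k)

/-- The cylinder `△(b₀, …, b_m)`. -/
def cylinder (d : ℕ) (b : ℕ → ℕ) (m : ℕ) : Set (Fin (d + 1) → ℝ) :=
  {x | ∀ k ≤ m, (triangleMap d)^[k] x ∈ subsimplex d (b k)}

/-- The triangle map converges weakly at `x`: the point `x` has an infinite triangle sequence
`(b₀, b₁, …)`, and the nested cylinders `△(b₀, …, b_m)` converge to `{x}` as `m → ∞`, both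
set-theoretically (their intersection is `{x}`) and topologically (they are eventually contained
in every neighbourhood of `x`). -/
def WeaklyConvergesAt (d : ℕ) (x : Fin (d + 1) → ℝ) : Prop :=
  ∃ b : ℕ → ℕ, IsTriangleSequence d x b ∧ (⋂ m : ℕ, cylinder d b m) = {x} ∧
    ∀ U ∈ 𝓝 x, ∀ᶠ m : ℕ in atTop, cylinder d b m ⊆ U

/-- On the piece `△_b` the digit is `b`. -/
theorem digit_eq_of_mem_subsimplex {d b : ℕ} {x : Fin (d + 1) → ℝ} (hx : x ∈ subsimplex d b) :
    digit d x = b := by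
  obtain ⟨⟨h1, -, h0⟩, h2, h3⟩ := hx
  have hpos : 0 < x (Fin.last d) := by
    rcases h0.lt_or_eq with h | h
    · exact h
    · rw [← h] at h2 h3
      linarith
  unfold digit
  rw [Nat.floor_eq_iff (div_nonneg (by linarith) h0), le_div_iff₀ hpos, div_lt_iff₀ hpos]
  constructor <;> linarith

/-- The triangle map sends each piece `△_b` into `△`. -/
theorem triangleMap_mem_simplex {d b : ℕ} {x : Fin (d + 1) → ℝ} (hx : x ∈ subsimplex d b) :
    triangleMap d x ∈ simplex d := by
  have hb := digit_eq_of_mem_subsimplex hx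
  obtain ⟨⟨h1, ha, h0⟩, h2, h3⟩ := hx
  have hpos : 0 < x (Fin.last d) := by
    rcases h0.lt_or_eq with h | h
    · exact h
    · rw [← h] at h2 h3
      linarith
  have h00 : 0 < x 0 := hpos.trans_le (ha (Fin.zero_le _))
  have hlast : triangleMap d x (Fin.last d) =
      (1 - x 0 - (b : ℝ) * x (Fin.last d)) / x 0 := by
    simp [triangleMap, hb]
  have hcast : ∀ i : Fin d, triangleMap d x i.castSucc = x i.succ / x 0 := by
    intro i
    simp [triangleMap]
  have hle : triangleMap d x (Fin.last d) ≤ x (Fin.last d) / x 0 := by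
    rw [hlast]
    exact div_le_div_of_nonneg_right (by linarith) h00.le
  have hanti : Antitone (triangleMap d x) := by
    intro i j hij
    induction j using Fin.lastCases with
    | last =>
      induction i using Fin.lastCases with
      | last => exact le_rfl
      | cast i =>
        rw [hcast]
        exact hle.trans (div_le_div_of_nonneg_right (ha (Fin.le_last _)) h00.le)
    | cast j =>
      induction i using Fin.lastCases with
      | last => exact absurd hij (not_le.mpr (Fin.castSucc_lt_last j))
      | cast i =>
        rw [hcast, hcast]
        exact div_le_div_of_nonneg_right
          (ha (Fin.succ_le_succ_iff.mpr (Fin.castSucc_le_castSucc_iff.mp hij))) h00.le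
  refine ⟨?_, hanti, ?_⟩
  · induction d with
    | zero =>
      exact hle.trans ((div_le_one h00).mpr (ha (Fin.zero_le _)))
    | succ d _ =>
      have := hcast 0
      rw [Fin.castSucc_zero] at this
      rw [this]
      exact (div_le_one h00).mpr (ha (Fin.zero_le _))
  · rw [hlast]
    exact div_nonneg h2 h00.le

end TriangleMap

/-!
In barycentric coordinates the triangle map acts on the cone over each `△_b` as a linear map of
determinant `±1`, and a digit `b` acts on linear functionals as a nonnegative matrix. A long enough
run of zero digits acts as a positive matrix, so it contracts the range of the ratio of two
functionals by a fixed factor (Birkhoff). Hence the cylinders of a point whose digits contain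
infinitely many such runs shrink to that point.

For a functional `q`, the part of the positive orthant where `q < 1` has volume proportional to
`weight q`, and the digits split this weight as a probability distribution. Consider the points
without a zero run of a given length and the least `H` such that the cone over them has volume at
most `H * weight q` for every positive monotone `q`. From such a `q`, with probability bounded
below, the next digits make the entries of the functional comparable and a zero run follows, so
`H > 0` could be lowered. Hence `H = 0`, and almost every point has infinitely many zero runs.
-/

namespace TriangleMap

section BarycentricCoordinates

/-- The linear map `(z₀, …, zₘ) ↦ (z₀ - z₁, …, zₘ₋₁ - zₘ, zₘ)`, which carries the cone of
nonnegative antitone vectors to the positive orthant. -/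
def consecutiveDiffs (m : ℕ) : (Fin (m + 1) → ℝ) →ₗ[ℝ] (Fin (m + 1) → ℝ) :=
  LinearMap.pi (Fin.snoc (α := fun _ => (Fin (m + 1) → ℝ) →ₗ[ℝ] ℝ)
    (fun i : Fin m => .proj i.castSucc - .proj i.succ) (.proj (Fin.last m)))

@[simp] theorem consecutiveDiffs_castSucc {m : ℕ} (z : Fin (m + 1) → ℝ) (i : Fin m) :
    consecutiveDiffs m z i.castSucc = z i.castSucc - z i.succ := by
  simp [consecutiveDiffs]

@[simp] theorem consecutiveDiffs_last {m : ℕ} (z : Fin (m + 1) → ℝ) :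
    consecutiveDiffs m z (Fin.last m) = z (Fin.last m) := by
  simp [consecutiveDiffs]

theorem det_consecutiveDiffs_ne_zero (m : ℕ) : LinearMap.det (consecutiveDiffs m) ≠ 0 := by
  suffices h : ∀ z, consecutiveDiffs m z = 0 → z = 0 from
    (LinearMap.isUnit_det _ ((LinearMap.isUnit_iff_ker_eq_bot _).2
      (LinearMap.ker_eq_bot'.2 h))).ne_zero
  intro z hz
  ext i
  induction i using Fin.reverseInduction with
  | last => simpa using congrFun hz (Fin.last m)
  | cast i ih =>
    have hdiff := congrFun hz i.castSucc
    rw [consecutiveDiffs_castSucc, ih] at hdiff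
    simpa using hdiff

theorem dotProduct_consecutiveDiffs {m : ℕ} (q z : Fin (m + 2) → ℝ) :
    q ⬝ᵥ consecutiveDiffs (m + 1) z =
      q 0 * z 0 + ∑ i : Fin (m + 1), (q i.succ - q i.castSucc) * z i.succ := by
  rw [dotProduct, Fin.sum_univ_castSucc]
  simp only [consecutiveDiffs_castSucc, consecutiveDiffs_last, mul_sub, sub_mul,
    Finset.sum_sub_distrib]
  have h₁ := Fin.sum_univ_castSucc fun i => q i * z i
  have h₂ := Fin.sum_univ_succ fun i => q i * z i
  linarith

/-- The barycentric coordinates `(1 - x₁, x₁ - x₂, …, xₙ₋₁ - xₙ, xₙ)` of `x` with respect to the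
vertices `(0, …, 0), (1, 0, …, 0), …, (1, …, 1)` of the simplex. -/
def barycentric {d : ℕ} (x : Fin (d + 1) → ℝ) : Fin (d + 2) → ℝ :=
  consecutiveDiffs (d + 1) (Fin.cons (α := fun _ => ℝ) 1 x)

/-- The row vector whose dot product with `barycentric x` is the coordinate `x j`. -/
noncomputable def coordRow {d : ℕ} (j : Fin (d + 1)) : Fin (d + 2) → ℝ :=
  (Ioi j.castSucc).indicator 1

variable {d : ℕ} {x : Fin (d + 1) → ℝ}

@[simp] theorem barycentric_zero : barycentric x 0 = 1 - x 0 := by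
  simpa [barycentric] using consecutiveDiffs_castSucc (Fin.cons (α := fun _ => ℝ) 1 x) 0

@[simp] theorem barycentric_last : barycentric x (Fin.last (d + 1)) = x (Fin.last d) := by
  rw [barycentric, consecutiveDiffs_last, ← Fin.succ_last, Fin.cons_succ]

@[simp] theorem barycentric_castSucc_succ (i : Fin d) :
    barycentric x i.castSucc.succ = x i.castSucc - x i.succ := by
  rw [barycentric, Fin.succ_castSucc, consecutiveDiffs_castSucc, ← Fin.succ_castSucc,
    Fin.cons_succ, Fin.cons_succ]

theorem barycentric_nonneg (hx : x ∈ simplex d) : 0 ≤ barycentric x := by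
  intro i
  induction i using Fin.lastCases with
  | last => simpa using hx.2.2
  | cast i =>
    induction i using Fin.cases with
    | zero => simpa using hx.1
    | succ i =>
      rw [← Fin.succ_castSucc, barycentric_castSucc_succ]
      exact sub_nonneg.2 (hx.2.1 i.castSucc_le_succ)

theorem dotProduct_barycentric (q : Fin (d + 2) → ℝ) (x : Fin (d + 1) → ℝ) :
    q ⬝ᵥ barycentric x = q 0 + ∑ i, (q i.succ - q i.castSucc) * x i := by
  simp [barycentric, dotProduct_consecutiveDiffs]

theorem one_dotProduct_barycentric (x : Fin (d + 1) → ℝ) : 1 ⬝ᵥ barycentric x = 1 := by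
  simp [dotProduct_barycentric]

theorem coordRow_dotProduct_barycentric (j : Fin (d + 1)) (x : Fin (d + 1) → ℝ) :
    coordRow j ⬝ᵥ barycentric x = x j := by
  have hjump (i : Fin (d + 1)) :
      (coordRow j i.succ - coordRow j i.castSucc : ℝ) = if i = j then 1 else 0 := by
    rcases lt_trichotomy i j with h | rfl | h
    · simp [coordRow, indicator, h.ne, h.not_gt, Fin.castSucc_lt_succ_iff, h.not_ge]
    · simp [coordRow, indicator]
    · simp [coordRow, indicator, h.ne', h, Fin.castSucc_lt_succ_iff, h.le]
  have hzero : (coordRow j 0 : ℝ) = 0 := by simp [coordRow]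
  simp [dotProduct_barycentric, hjump, hzero]

end BarycentricCoordinates

section Digits

variable {d b : ℕ} {x : Fin (d + 1) → ℝ}

/-- The points of the simplex with positive last coordinate; this is the union of the pieces
`△_b`, on which the triangle map is defined. -/
def digitDomain (d : ℕ) : Set (Fin (d + 1) → ℝ) := {x | x ∈ simplex d ∧ 0 < x (Fin.last d)}

theorem mem_subsimplex_digit (hx : x ∈ digitDomain d) : x ∈ subsimplex d (digit d x) := by
  obtain ⟨hx, hlast⟩ := hx
  have hratio : 0 ≤ (1 - x 0) / x (Fin.last d) := div_nonneg (by linarith [hx.1]) hlast.le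
  have hle := (le_div_iff₀ hlast).1 (Nat.floor_le hratio)
  have hlt := (div_lt_iff₀ hlast).1 (Nat.lt_floor_add_one ((1 - x 0) / x (Fin.last d)))
  refine ⟨hx, ?_, ?_⟩ <;> unfold digit <;> linarith

theorem last_pos_of_mem_subsimplex (hx : x ∈ subsimplex d b) : 0 < x (Fin.last d) := by
  obtain ⟨⟨-, -, hlast⟩, hle, hlt⟩ := hx
  refine hlast.lt_of_ne fun h => ?_
  rw [← h] at hle hlt
  linarith

theorem zero_pos_of_mem_subsimplex (hx : x ∈ subsimplex d b) : 0 < x 0 :=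
  (last_pos_of_mem_subsimplex hx).trans_le (hx.1.2.1 (Fin.zero_le _))

theorem triangleMap_castSucc (x : Fin (d + 1) → ℝ) (i : Fin d) :
    triangleMap d x i.castSucc = x i.succ / x 0 := by
  simp [triangleMap]

theorem triangleMap_last (hx : x ∈ subsimplex d b) :
    triangleMap d x (Fin.last d) = (1 - x 0 - b * x (Fin.last d)) / x 0 := by
  simp [triangleMap, digit_eq_of_mem_subsimplex hx]

end Digits

section LinearBranches

/-- The linear map which the triangle map induces on barycentric coordinates over the piece
`△_b`, up to a positive factor. -/
def coneMap (d b : ℕ) : (Fin (d + 2) → ℝ) →ₗ[ℝ] (Fin (d + 2) → ℝ) :=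
  LinearMap.pi (Fin.snoc (α := fun _ => (Fin (d + 2) → ℝ) →ₗ[ℝ] ℝ)
    (Fin.snoc (α := fun _ => (Fin (d + 2) → ℝ) →ₗ[ℝ] ℝ) (fun i : Fin d => .proj i.castSucc.succ)
      (((b : ℝ) + 1) • .proj (Fin.last (d + 1)) - .proj 0))
    (.proj 0 - (b : ℝ) • .proj (Fin.last (d + 1))))

/-- The action of a digit `b` on linear functionals, written as row vectors in barycentric
coordinates: the inverse transpose of `coneMap d b`. -/
def rowStep (d b : ℕ) : (Fin (d + 2) → ℝ) →ₗ[ℝ] (Fin (d + 2) → ℝ) :=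
  LinearMap.pi (Fin.snoc (α := fun _ => (Fin (d + 2) → ℝ) →ₗ[ℝ] ℝ)
    (Fin.snoc (α := fun _ => (Fin (d + 2) → ℝ) →ₗ[ℝ] ℝ) (fun i : Fin d => .proj i.castSucc.succ)
      (.proj (Fin.last (d + 1)) + (b : ℝ) • .proj 0))
    (.proj (Fin.last (d + 1)) + ((b : ℝ) + 1) • .proj 0))

variable {d : ℕ} (b : ℕ) (q v : Fin (d + 2) → ℝ)

@[simp] theorem coneMap_last :
    coneMap d b v (Fin.last (d + 1)) = v 0 - b * v (Fin.last (d + 1)) := by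
  simp [coneMap]

@[simp] theorem coneMap_castSucc_last :
    coneMap d b v (Fin.last d).castSucc = (b + 1) * v (Fin.last (d + 1)) - v 0 := by
  simp [coneMap, Fin.snoc_castSucc]

@[simp] theorem coneMap_castSucc_castSucc (i : Fin d) :
    coneMap d b v i.castSucc.castSucc = v i.castSucc.succ := by
  simp [coneMap]

@[simp] theorem rowStep_last :
    rowStep d b q (Fin.last (d + 1)) = q (Fin.last (d + 1)) + (b + 1) * q 0 := by
  simp [rowStep]

@[simp] theorem rowStep_castSucc_last :
    rowStep d b q (Fin.last d).castSucc = q (Fin.last (d + 1)) + b * q 0 := by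
  simp [rowStep]

@[simp] theorem rowStep_castSucc_castSucc (i : Fin d) :
    rowStep d b q i.castSucc.castSucc = q i.castSucc.succ := by
  simp [rowStep]

theorem rowStep_dotProduct_coneMap : rowStep d b q ⬝ᵥ coneMap d b v = q ⬝ᵥ v := by
  rw [dotProduct, Fin.sum_univ_castSucc, Fin.sum_univ_castSucc, dotProduct, Fin.sum_univ_castSucc,
    Fin.sum_univ_succ]
  simp only [coneMap_last, coneMap_castSucc_last, coneMap_castSucc_castSucc, rowStep_last,
    rowStep_castSucc_last, rowStep_castSucc_castSucc, Fin.castSucc_zero, ← Fin.succ_castSucc]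
  ring

theorem coneMap_barycentric {x : Fin (d + 1) → ℝ} (hx : x ∈ subsimplex d b) :
    coneMap d b (barycentric x) = x 0 • barycentric (triangleMap d x) := by
  have hx₀ : x 0 ≠ 0 := (zero_pos_of_mem_subsimplex hx).ne'
  have hscale (i : Fin (d + 1)) :
      x 0 * Fin.cons (α := fun _ => ℝ) 1 (triangleMap d x) i.castSucc = x i := by
    induction i using Fin.cases with
    | zero => simp
    | succ i =>
      rw [← Fin.succ_castSucc, Fin.cons_succ, triangleMap_castSucc, mul_div_cancel₀ _ hx₀]
  have hlast : x 0 * triangleMap d x (Fin.last d) = 1 - x 0 - b * x (Fin.last d) := by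
    rw [triangleMap_last hx, mul_div_cancel₀ _ hx₀]
  ext i
  rw [Pi.smul_apply, smul_eq_mul]
  induction i using Fin.lastCases with
  | last => simp [hlast]
  | cast i =>
    rw [barycentric.eq_def (triangleMap d x), consecutiveDiffs_castSucc, mul_sub, hscale,
      Fin.cons_succ]
    induction i using Fin.lastCases with
    | last => rw [coneMap_castSucc_last, hlast, barycentric_last, barycentric_zero]; ring
    | cast i =>
      rw [coneMap_castSucc_castSucc, barycentric_castSucc_succ, triangleMap_castSucc,
        mul_div_cancel₀ _ hx₀]

theorem coneMap_eq_comp_transvection : coneMap d b =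
    LinearMap.transvection (-LinearMap.proj (Fin.last (d + 1)))
      (Pi.single (Fin.last d).castSucc 1) ∘ₗ
    LinearMap.transvection (-(b : ℝ) • LinearMap.proj (Fin.last d).castSucc)
      (Pi.single (Fin.last (d + 1)) 1) ∘ₗ
    Matrix.toLin' (Equiv.Perm.permMatrix ℝ (finRotate (d + 2))) := by
  have hne : (Fin.last d).castSucc ≠ Fin.last (d + 1) := (Fin.castSucc_lt_last _).ne
  have hrotate (i : Fin (d + 1)) : finRotate (d + 2) i.castSucc = i.succ := by
    rw [finRotate_apply, Fin.coeSucc_eq_succ]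
  refine LinearMap.ext fun v => funext fun i => ?_
  simp only [LinearMap.comp_apply, Matrix.toLin'_apply, Matrix.permMatrix_mulVec,
    LinearMap.transvection.apply]
  induction i using Fin.lastCases with
  | last => simp [hne.symm, hrotate, sub_eq_add_neg]
  | cast i =>
    induction i using Fin.lastCases with
    | last => simp [hne, hrotate]; ring
    | cast i =>
      have hne₁ : i.castSucc.castSucc ≠ Fin.last (d + 1) := (Fin.castSucc_lt_last _).ne
      have hne₂ : i.castSucc.castSucc ≠ (Fin.last d).castSucc := by
        simp [(Fin.castSucc_lt_last i).ne]
      simp [hne₁, hne₂, hrotate]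

theorem abs_det_coneMap : |LinearMap.det (coneMap d b)| = 1 := by
  have hne : (Fin.last d).castSucc ≠ Fin.last (d + 1) := (Fin.castSucc_lt_last _).ne
  rw [coneMap_eq_comp_transvection, LinearMap.det_comp, LinearMap.det_comp, LinearMap.det_toLin',
    Matrix.det_permutation, LinearMap.transvection.det, LinearMap.transvection.det]
  simp [hne, hne.symm]

theorem volume_preimage_coneMap (s : Set (Fin (d + 2) → ℝ)) :
    volume (coneMap d b ⁻¹' s) = volume s := by
  have hdet := abs_det_coneMap (d := d) b
  rw [Measure.addHaar_preimage_linearMap _ (abs_pos.1 (hdet ▸ one_pos)), abs_inv, hdet]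
  simp

end LinearBranches

section RowStep

variable {d : ℕ} {q : Fin (d + 2) → ℝ}

theorem rowStep_nonneg (b : ℕ) (hq : 0 ≤ q) : 0 ≤ rowStep d b q := by
  intro i
  have hfirst : 0 ≤ q 0 := hq 0
  have hlast : 0 ≤ q (Fin.last (d + 1)) := hq _
  induction i using Fin.lastCases with
  | last => rw [Pi.zero_apply, rowStep_last]; positivity
  | cast i =>
    induction i using Fin.lastCases with
    | last => rw [Pi.zero_apply, rowStep_castSucc_last]; positivity
    | cast i => simpa using hq _

theorem rowStep_pos (b : ℕ) (hq : ∀ i, 0 < q i) (i : Fin (d + 2)) : 0 < rowStep d b q i := by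
  have hfirst : 0 < q 0 := hq 0
  have hlast : 0 < q (Fin.last (d + 1)) := hq _
  induction i using Fin.lastCases with
  | last => rw [rowStep_last]; positivity
  | cast i =>
    induction i using Fin.lastCases with
    | last => rw [rowStep_castSucc_last]; positivity
    | cast i => simpa using hq _

theorem succ_le_rowStep_castSucc (b : ℕ) (hq : 0 ≤ q 0) (i : Fin (d + 1)) :
    q i.succ ≤ rowStep d b q i.castSucc := by
  induction i using Fin.lastCases with
  | last => rw [rowStep_castSucc_last, Fin.succ_last]; exact le_add_of_nonneg_right (by positivity)
  | cast i => rw [rowStep_castSucc_castSucc]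

theorem last_le_rowStep_last (b : ℕ) (hq : 0 ≤ q 0) :
    q (Fin.last (d + 1)) ≤ rowStep d b q (Fin.last (d + 1)) := by
  rw [rowStep_last]
  exact le_add_of_nonneg_right (by positivity)

theorem monotone_rowStep (b : ℕ) (hq₀ : 0 ≤ q 0) (hq : Monotone q) :
    Monotone (rowStep d b q) := by
  rw [Fin.monotone_iff_le_succ]
  intro i
  induction i using Fin.lastCases with
  | last => rw [rowStep_castSucc_last, Fin.succ_last, rowStep_last]; linarith
  | cast i =>
    rw [rowStep_castSucc_castSucc, Fin.succ_castSucc]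
    exact (hq (Fin.castSucc_le_succ _)).trans (succ_le_rowStep_castSucc b hq₀ i.succ)

theorem rowStep_zero_le_two_mul {c : ℝ} (hc : 0 ≤ c) (hq : ∀ i, q i ≤ c) (i : Fin (d + 2)) :
    rowStep d 0 q i ≤ 2 * c := by
  have hfirst := hq 0
  have hlast := hq (Fin.last (d + 1))
  induction i using Fin.lastCases with
  | last => rw [rowStep_last, Nat.cast_zero]; linarith
  | cast i =>
    induction i using Fin.lastCases with
    | last => rw [rowStep_castSucc_last, Nat.cast_zero]; linarith
    | cast i => rw [rowStep_castSucc_castSucc]; linarith [hq i.castSucc.succ]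

end RowStep

section ZeroDigits

variable {d : ℕ} {q : Fin (d + 2) → ℝ}

theorem rowStep_pow_nonneg (b k : ℕ) (hq : 0 ≤ q) : 0 ≤ (rowStep d b ^ k) q := by
  induction k with
  | zero => exact hq
  | succ k ih => rw [pow_succ', Module.End.mul_apply]; exact rowStep_nonneg b ih

theorem last_le_rowStep_pow_last (b k : ℕ) (hq : 0 ≤ q) :
    q (Fin.last (d + 1)) ≤ (rowStep d b ^ k) q (Fin.last (d + 1)) := by
  induction k with
  | zero => exact le_rfl
  | succ k ih =>
    rw [pow_succ', Module.End.mul_apply]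
    exact ih.trans (last_le_rowStep_last b (rowStep_pow_nonneg b k hq 0))

theorem le_rowStep_pow_last (b : ℕ) {k : ℕ} (hq : 0 ≤ q) (i : Fin (d + 2)) (hi : (i : ℕ) < k) :
    q i ≤ (rowStep d b ^ k) q (Fin.last (d + 1)) := by
  induction k generalizing q i with
  | zero => exact absurd hi (Nat.not_lt_zero _)
  | succ k ih =>
    have hstep := rowStep_nonneg b hq
    rw [pow_succ, Module.End.mul_apply]
    induction i using Fin.cases with
    | zero =>
      have hfirst : q 0 ≤ rowStep d b q (Fin.last (d + 1)) := by
        have hlast : 0 ≤ q (Fin.last (d + 1)) := hq _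
        have hmul : 0 ≤ b * q 0 := mul_nonneg b.cast_nonneg (hq 0)
        rw [rowStep_last]
        linarith
      exact hfirst.trans (last_le_rowStep_pow_last b k hstep)
    | succ i =>
      exact (succ_le_rowStep_castSucc b (hq 0) i).trans
        (ih hstep i.castSucc (Nat.succ_lt_succ_iff.1 hi))

theorem last_le_rowStep_pow (b : ℕ) {k : ℕ} (hq : 0 ≤ q) (i : Fin (d + 2)) (hi : d + 1 ≤ i + k) :
    q (Fin.last (d + 1)) ≤ (rowStep d b ^ k) q i := by
  induction k generalizing i with
  | zero =>
    obtain rfl : i = Fin.last (d + 1) := Fin.ext (by simp only [Fin.val_last]; lia)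
    exact le_rfl
  | succ k ih =>
    induction i using Fin.lastCases with
    | last => exact last_le_rowStep_pow_last b _ hq
    | cast i =>
      rw [pow_succ', Module.End.mul_apply]
      refine (ih i.succ ?_).trans
        (succ_le_rowStep_castSucc b (rowStep_pow_nonneg b k hq 0) i)
      simp only [Fin.val_castSucc, Fin.val_succ] at hi ⊢
      lia

/-- A number of repetitions of a digit after which every entry of a row has contributed to every
entry of its image: `d + 2` steps to reach the last entry and `d + 1` steps to spread from it. -/
def mixingLength (d : ℕ) : ℕ := (d + 1) + (d + 2)

theorem le_rowStep_pow_mixingLength (b : ℕ) (hq : 0 ≤ q) (i j : Fin (d + 2)) :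
    q i ≤ (rowStep d b ^ mixingLength d) q j := by
  rw [mixingLength, pow_add, Module.End.mul_apply]
  exact (le_rowStep_pow_last b hq i i.isLt).trans
    (last_le_rowStep_pow b (rowStep_pow_nonneg b _ hq) j (Nat.le_add_left _ _))

theorem rowStep_zero_pow_le {c : ℝ} (hc : 0 ≤ c) (hq : ∀ i, q i ≤ c) (k : ℕ) (i : Fin (d + 2)) :
    (rowStep d 0 ^ k) q i ≤ 2 ^ k * c := by
  induction k generalizing i with
  | zero => simpa using hq i
  | succ k ih =>
    rw [pow_succ', Module.End.mul_apply, pow_succ', mul_assoc]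
    exact rowStep_zero_le_two_mul (by positivity) ih i

theorem rowStep_zero_pow_mixingLength_comparable (hq : 0 ≤ q) (i j : Fin (d + 2)) :
    (2 ^ mixingLength d)⁻¹ * (rowStep d 0 ^ mixingLength d) q i ≤
      (rowStep d 0 ^ mixingLength d) q j := by
  rw [inv_mul_le_iff₀ (by positivity)]
  exact rowStep_zero_pow_le (rowStep_pow_nonneg 0 _ hq j)
    (fun i => le_rowStep_pow_mixingLength 0 hq i j) _ i

end ZeroDigits

-- With `r = A q`, `e = A (a - m • q)` and `t = e i / r i`, comparability gives `c² t r ≤ e`, and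
-- symmetrically from above; the two gains add up to `c² (M - m)`.
theorem exists_pinch_of_comparable {𝕜 V κ : Type*} [Field 𝕜] [LinearOrder 𝕜]
    [IsStrictOrderedRing 𝕜] [AddCommGroup V] [PartialOrder V] [Module 𝕜 V]
    (A : V →ₗ[𝕜] κ → 𝕜) {c : 𝕜} (hc : 0 ≤ c) (hA₀ : ∀ v, 0 ≤ v → 0 ≤ A v)
    (hA : ∀ v, 0 ≤ v → ∀ i j, c * A v i ≤ A v j) {q a : V} {m M : 𝕜} (hq : 0 ≤ q)
    (hm : 0 ≤ a - m • q) (hM : 0 ≤ M • q - a) {i : κ} (hi : 0 < A q i) :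
    ∃ m' M', 0 ≤ A (a - m' • q) ∧ 0 ≤ A (M' • q - a) ∧ M' - m' = (1 - c ^ 2) * (M - m) := by
  have gain {v : V} (hv : 0 ≤ v) (j : κ) : c ^ 2 * (A v i / A q i) * A q j ≤ A v j :=
    calc c ^ 2 * (A v i / A q i) * A q j = c * (A v i / A q i) * (c * A q j) := by ring
      _ ≤ c * (A v i / A q i) * A q i := by
        gcongr
        · exact mul_nonneg hc (div_nonneg (hA₀ v hv i) hi.le)
        · exact hA q hq j i
      _ = c * A v i := by field_simp
      _ ≤ A v j := hA v hv i j
  refine ⟨m + c ^ 2 * (A (a - m • q) i / A q i), M - c ^ 2 * (A (M • q - a) i / A q i),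
    fun j => ?_, fun j => ?_, ?_⟩
  · have := gain hm j
    simp only [map_sub, map_smul, Pi.sub_apply, Pi.smul_apply, Pi.zero_apply, smul_eq_mul] at this ⊢
    linarith
  · have := gain hM j
    simp only [map_sub, map_smul, Pi.sub_apply, Pi.smul_apply, Pi.zero_apply, smul_eq_mul] at this ⊢
    linarith
  · simp only [map_sub, map_smul, Pi.sub_apply, Pi.smul_apply, smul_eq_mul]
    field_simp
    ring

section RowProduct

/-- The composition of the row actions of the digits `b 0, …, b (m - 1)`. -/
def rowProduct (d : ℕ) (b : ℕ → ℕ) : ℕ → (Fin (d + 2) → ℝ) →ₗ[ℝ] (Fin (d + 2) → ℝ)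
  | 0 => LinearMap.id
  | m + 1 => rowStep d (b m) ∘ₗ rowProduct d b m

variable {d : ℕ} {b : ℕ → ℕ} {q a : Fin (d + 2) → ℝ}

theorem rowProduct_nonneg_of_le {m m' : ℕ} (hm : m ≤ m') (hq : 0 ≤ rowProduct d b m q) :
    0 ≤ rowProduct d b m' q := by
  induction m', hm using Nat.le_induction with
  | base => exact hq
  | succ k _ ih => exact rowStep_nonneg _ ih

theorem rowProduct_pos (hq : ∀ i, 0 < q i) (m : ℕ) : ∀ i, 0 < rowProduct d b m q i := by
  induction m with
  | zero => exact hq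
  | succ m ih => exact rowStep_pos _ ih

theorem rowProduct_add_of_eq_zero {m k : ℕ} (h : ∀ i < k, b (m + i) = 0) :
    rowProduct d b (m + k) = (rowStep d 0 ^ k) ∘ₗ rowProduct d b m := by
  induction k with
  | zero => rfl
  | succ k ih =>
    rw [← add_assoc, rowProduct, h k k.lt_succ_self, ih fun i hi => h i (hi.trans k.lt_succ_self),
      pow_succ', Module.End.mul_eq_comp, LinearMap.comp_assoc]

theorem exists_pinch_of_zero_run {j : ℕ} (hzero : ∀ i < mixingLength d, b (j + i) = 0)
    (hq : ∀ i, 0 < q i) {m M : ℝ} (hm : 0 ≤ rowProduct d b j (a - m • q))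
    (hM : 0 ≤ rowProduct d b j (M • q - a)) :
    ∃ m' M', 0 ≤ rowProduct d b (j + mixingLength d) (a - m' • q) ∧
      0 ≤ rowProduct d b (j + mixingLength d) (M' • q - a) ∧
      M' - m' = (1 - ((2 : ℝ) ^ mixingLength d)⁻¹ ^ 2) * (M - m) := by
  have hpos := rowProduct_pos (b := b) hq j
  have hpos' := rowProduct_pos (b := b) hq (j + mixingLength d)
  rw [rowProduct_add_of_eq_zero hzero] at hpos' ⊢
  simp only [map_sub, map_smul] at hm hM
  simpa only [map_sub, map_smul, LinearMap.comp_apply] using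
    exists_pinch_of_comparable (rowStep d 0 ^ mixingLength d) (by positivity)
      (fun v hv => rowStep_pow_nonneg 0 _ hv)
      (fun v hv => rowStep_zero_pow_mixingLength_comparable hv) (fun i => (hpos i).le) hm hM
      (hpos' 0)

theorem exists_pinch_of_frequently_zero_run
    (hb : ∃ᶠ j in atTop, ∀ i < mixingLength d, b (j + i) = 0)
    (hq : ∀ i, 0 < q i) (ha : 0 ≤ a) (haq : a ≤ q) (r : ℕ) :
    ∃ N m M, 0 ≤ rowProduct d b N (a - m • q) ∧ 0 ≤ rowProduct d b N (M • q - a) ∧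
      M - m = (1 - ((2 : ℝ) ^ mixingLength d)⁻¹ ^ 2) ^ r := by
  induction r with
  | zero =>
    exact ⟨0, 0, 1, by simpa [rowProduct] using ha, by simpa [rowProduct] using haq, by simp⟩
  | succ r ih =>
    obtain ⟨N, m, M, hm, hM, hMm⟩ := ih
    obtain ⟨j, hNj, hzero⟩ := frequently_atTop.1 hb N
    obtain ⟨m', M', hm', hM', hMm'⟩ := exists_pinch_of_zero_run hzero hq
      (rowProduct_nonneg_of_le hNj hm) (rowProduct_nonneg_of_le hNj hM)
    exact ⟨_, m', M', hm', hM', by rw [hMm', hMm, pow_succ' _ r]⟩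

end RowProduct

section WeakConvergence

variable {d : ℕ} {b : ℕ → ℕ} {x y : Fin (d + 1) → ℝ}

theorem exists_dotProduct_barycentric_eq_mul (hy : y ∈ simplex d) (m : ℕ)
    (hdigits : ∀ k < m, (triangleMap d)^[k] y ∈ subsimplex d (b k)) :
    (triangleMap d)^[m] y ∈ simplex d ∧ ∃ c > 0, ∀ q, q ⬝ᵥ barycentric y =
      c * (rowProduct d b m q ⬝ᵥ barycentric ((triangleMap d)^[m] y)) := by
  induction m with
  | zero => exact ⟨hy, 1, one_pos, fun q => by simp [rowProduct]⟩
  | succ m ih =>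
    obtain ⟨-, c, hc, hdot⟩ := ih fun k hk => hdigits k (hk.trans m.lt_succ_self)
    have hm := hdigits m m.lt_succ_self
    rw [Function.iterate_succ_apply']
    refine ⟨triangleMap_mem_simplex hm, _, mul_pos hc (zero_pos_of_mem_subsimplex hm), ?_⟩
    intro q
    rw [hdot, ← rowStep_dotProduct_coneMap (b m), coneMap_barycentric _ hm, dotProduct_smul,
      smul_eq_mul, mul_assoc]
    rfl

theorem dotProduct_barycentric_nonneg_of_mem_cylinder {N : ℕ} {q : Fin (d + 2) → ℝ}
    (hq : 0 ≤ rowProduct d b N q) (hy : y ∈ cylinder d b N) : 0 ≤ q ⬝ᵥ barycentric y := by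
  obtain ⟨hmem, c, hc, hdot⟩ := exists_dotProduct_barycentric_eq_mul (y := y)
    (hy 0 N.zero_le).1 N fun k hk => hy k hk.le
  rw [hdot]
  exact mul_nonneg hc.le (dotProduct_nonneg_of_nonneg hq (barycentric_nonneg hmem))

theorem mem_Icc_of_mem_cylinder {N : ℕ} {m M : ℝ} {j : Fin (d + 1)}
    (hm : 0 ≤ rowProduct d b N (coordRow j - m • 1))
    (hM : 0 ≤ rowProduct d b N (M • 1 - coordRow j)) (hy : y ∈ cylinder d b N) :
    y j ∈ Icc m M := by
  have hlower := dotProduct_barycentric_nonneg_of_mem_cylinder hm hy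
  have hupper := dotProduct_barycentric_nonneg_of_mem_cylinder hM hy
  simp only [sub_dotProduct, smul_dotProduct, coordRow_dotProduct_barycentric,
    one_dotProduct_barycentric, smul_eq_mul, mul_one, sub_nonneg] at hlower hupper
  exact ⟨hlower, hupper⟩

theorem eventually_cylinder_dist_coord_lt
    (hb : ∃ᶠ j in atTop, ∀ i < mixingLength d, b (j + i) = 0) (j : Fin (d + 1)) {ε : ℝ}
    (hε : 0 < ε) :
    ∀ᶠ N in atTop, ∀ y ∈ cylinder d b N, ∀ z ∈ cylinder d b N, dist (y j) (z j) < ε := by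
  have hrate : 1 - ((2 : ℝ) ^ mixingLength d)⁻¹ ^ 2 < 1 := sub_lt_self _ (by positivity)
  obtain ⟨r, hr⟩ := exists_pow_lt_of_lt_one hε hrate
  obtain ⟨N, m, M, hm, hM, hMm⟩ := exists_pinch_of_frequently_zero_run (q := 1)
    (a := coordRow j) hb (fun _ => one_pos) (indicator_nonneg fun _ _ => zero_le_one)
    (indicator_le_self' fun _ _ => zero_le_one) r
  filter_upwards [eventually_ge_atTop N] with N' hN y hy z hz
  have hIcc {w : Fin (d + 1) → ℝ} (hw : w ∈ cylinder d b N') : w j ∈ Icc m M :=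
    mem_Icc_of_mem_cylinder (rowProduct_nonneg_of_le hN hm) (rowProduct_nonneg_of_le hN hM) hw
  exact (Real.dist_le_of_mem_Icc (hIcc hy) (hIcc hz)).trans_lt (hMm ▸ hr)

theorem IsTriangleSequence.mem_cylinder (hx : IsTriangleSequence d x b) (m : ℕ) :
    x ∈ cylinder d b m :=
  fun k _ => hx k

theorem weaklyConvergesAt_of_frequently_zero_run (hx : IsTriangleSequence d x b)
    (hb : ∃ᶠ j in atTop, ∀ i < mixingLength d, b (j + i) = 0) : WeaklyConvergesAt d x := by
  have hnhds : ∀ U ∈ 𝓝 x, ∀ᶠ m : ℕ in atTop, cylinder d b m ⊆ U := by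
    intro U hU
    obtain ⟨ε, hε, hball⟩ := Metric.mem_nhds_iff.1 hU
    filter_upwards [eventually_all.2 fun j => eventually_cylinder_dist_coord_lt hb j hε]
      with N hN y hy
    exact hball ((dist_pi_lt_iff hε).2 fun j => hN j y hy x (hx.mem_cylinder N))
  refine ⟨b, hx, Subset.antisymm (fun y hy => ?_) ?_, hnhds⟩
  · by_contra hne
    obtain ⟨N, hN⟩ := (hnhds {y}ᶜ (isOpen_compl_singleton.mem_nhds (Ne.symm hne))).exists
    exact hN (mem_iInter.1 hy N) rfl
  · exact singleton_subset_iff.2 (mem_iInter.2 hx.mem_cylinder)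

end WeakConvergence

section ConeVolume

/-- The open cone spanned by the barycentric coordinates of the points of `X`. -/
def cone {d : ℕ} (X : Set (Fin (d + 1) → ℝ)) : Set (Fin (d + 2) → ℝ) :=
  {u | ∃ c : ℝ, 0 < c ∧ ∃ x ∈ X, u = c • barycentric x}

/-- The volume of the cone over `X`, truncated where the linear functional `q` reaches `1`. -/
noncomputable def coneVol {d : ℕ} (X : Set (Fin (d + 1) → ℝ)) (q : Fin (d + 2) → ℝ) : ENNReal :=
  volume (cone X ∩ {u | q ⬝ᵥ u < 1})

/-- `(d + 2)!` times the volume of the simplex `{u ≥ 0 | q ⬝ᵥ u < 1}`, for a positive row `q`. -/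
noncomputable def weight {d : ℕ} (q : Fin (d + 2) → ℝ) : ℝ := ∏ i, (q i)⁻¹

variable {d : ℕ} {X Y : Set (Fin (d + 1) → ℝ)} {q : Fin (d + 2) → ℝ}

theorem cone_mono (h : X ⊆ Y) : cone X ⊆ cone Y := by
  rintro u ⟨c, hc, x, hx, rfl⟩
  exact ⟨c, hc, x, h hx, rfl⟩

theorem coneVol_mono (h : X ⊆ Y) (q : Fin (d + 2) → ℝ) : coneVol X q ≤ coneVol Y q :=
  measure_mono (inter_subset_inter_left _ (cone_mono h))

theorem cone_subset_iUnion (hX : X ⊆ digitDomain d) :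
    cone X ⊆ ⋃ b, coneMap d b ⁻¹' cone (triangleMap d '' (X ∩ subsimplex d b)) := by
  rintro u ⟨c, hc, x, hx, rfl⟩
  have hdigit := mem_subsimplex_digit (hX hx)
  refine mem_iUnion.2 ⟨digit d x, c * x 0, mul_pos hc (zero_pos_of_mem_subsimplex hdigit), _,
    mem_image_of_mem _ ⟨hx, hdigit⟩, ?_⟩
  rw [map_smul, coneMap_barycentric _ hdigit, mul_smul]

theorem coneVol_le_tsum (hX : X ⊆ digitDomain d) (q : Fin (d + 2) → ℝ) :
    coneVol X q ≤ ∑' b, coneVol (triangleMap d '' (X ∩ subsimplex d b)) (rowStep d b q) := by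
  have hcover : cone X ∩ {u | q ⬝ᵥ u < 1} ⊆ ⋃ b, coneMap d b ⁻¹'
      (cone (triangleMap d '' (X ∩ subsimplex d b)) ∩ {u | rowStep d b q ⬝ᵥ u < 1}) := by
    rintro u ⟨hu, hq⟩
    obtain ⟨b, hb⟩ := mem_iUnion.1 (cone_subset_iUnion hX hu)
    exact mem_iUnion.2 ⟨b, hb, (rowStep_dotProduct_coneMap b q u).trans_lt hq⟩
  calc coneVol X q
    _ ≤ ∑' b, volume (coneMap d b ⁻¹'
        (cone (triangleMap d '' (X ∩ subsimplex d b)) ∩ {u | rowStep d b q ⬝ᵥ u < 1})) :=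
      (measure_mono hcover).trans (measure_iUnion_le _)
    _ = ∑' b, coneVol (triangleMap d '' (X ∩ subsimplex d b)) (rowStep d b q) :=
      tsum_congr fun b => volume_preimage_coneMap b _

theorem volume_cone_eq_zero_of_mapsTo (hX : X ⊆ digitDomain d) (hT : MapsTo (triangleMap d) X Y)
    (hY : volume (cone Y) = 0) : volume (cone X) = 0 := by
  refine measure_mono_null (cone_subset_iUnion hX) (measure_iUnion_null fun b => ?_)
  rw [volume_preimage_coneMap]
  exact measure_mono_null (cone_mono (hT.mono_left inter_subset_left).image_subset) hY

theorem weight_pos (hq : ∀ i, 0 < q i) : 0 < weight q :=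
  Finset.prod_pos fun i _ => inv_pos.2 (hq i)

theorem coneVol_le_weight (hX : X ⊆ simplex d) (hq : ∀ i, 0 < q i) :
    coneVol X q ≤ ENNReal.ofReal (weight q) := by
  have hbox : cone X ∩ {u | q ⬝ᵥ u < 1} ⊆ Icc 0 q⁻¹ := by
    rintro _ ⟨⟨c, hc, x, hx, rfl⟩, hlt⟩
    have hu : 0 ≤ c • barycentric x := smul_nonneg hc.le (barycentric_nonneg (hX hx))
    refine ⟨hu, fun i => ?_⟩
    have hterm : q i * (c • barycentric x) i ≤ q ⬝ᵥ (c • barycentric x) :=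
      Finset.single_le_sum (f := fun i => q i * (c • barycentric x) i)
        (fun j _ => mul_nonneg (hq j).le (hu j)) (Finset.mem_univ i)
    rw [Pi.inv_apply, ← one_div, le_div_iff₀' (hq i)]
    exact hterm.trans hlt.le
  calc coneVol X q
    _ ≤ volume (Icc 0 q⁻¹) := measure_mono hbox
    _ = ENNReal.ofReal (weight q) := by
      rw [Real.volume_Icc_pi, weight,
        ENNReal.ofReal_prod_of_nonneg fun i _ => (inv_pos.2 (hq i)).le]
      simp

theorem volume_cone_eq_zero_of_coneVol (h : ∀ c > 0, coneVol X (fun _ => c) = 0) :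
    volume (cone X) = 0 := by
  have hexhaust : cone X ⊆ ⋃ m : ℕ, cone X ∩ {u | (fun _ => ((m : ℝ) + 1)⁻¹) ⬝ᵥ u < 1} := by
    intro u hu
    obtain ⟨m, hm⟩ := exists_nat_gt (∑ i, u i)
    refine mem_iUnion.2 ⟨m, hu, ?_⟩
    simp only [mem_ofPred_eq, dotProduct, ← Finset.mul_sum]
    rw [inv_mul_lt_iff₀ (by positivity)]
    linarith
  exact measure_mono_null hexhaust (measure_iUnion_null fun m => h _ (by positivity))

end ConeVolume

section DigitDistribution

variable {d : ℕ} {q : Fin (d + 2) → ℝ}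

/-- The proportion of `{u ≥ 0 | q ⬝ᵥ u < 1}`, by volume, taken up by the digits `≥ b`. -/
noncomputable def tailProb (q : Fin (d + 2) → ℝ) (b : ℕ) : ℝ :=
  q (Fin.last (d + 1)) / (q (Fin.last (d + 1)) + b * q 0)

theorem weight_rowStep (b : ℕ) (hq : ∀ i, 0 < q i) :
    weight (rowStep d b q) = weight q * tailProb q b - weight q * tailProb q (b + 1) := by
  have hfirst := hq 0
  have hlast := hq (Fin.last (d + 1))
  have hb : q (Fin.last (d + 1)) + b * q 0 ≠ 0 := by positivity
  unfold weight tailProb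
  rw [Fin.prod_univ_castSucc, Fin.prod_univ_castSucc, Fin.prod_univ_succ (n := d + 1),
    Fin.prod_univ_castSucc (n := d)]
  simp only [rowStep_last, rowStep_castSucc_last, rowStep_castSucc_castSucc, Fin.succ_last]
  push_cast
  field_simp
  ring

theorem tendsto_tailProb (hq : 0 < q 0) : Tendsto (tailProb q) atTop (𝓝 0) :=
  (tendsto_atTop_add_const_left _ _
    (tendsto_natCast_atTop_atTop.atTop_mul_const hq)).const_div_atTop _

theorem hasSum_weight_rowStep_add (hq : ∀ i, 0 < q i) (B : ℕ) :
    HasSum (fun b => weight (rowStep d (b + B) q)) (weight q * tailProb q B) := by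
  rw [hasSum_iff_tendsto_nat_of_nonneg fun b => (weight_pos (rowStep_pos _ hq)).le]
  have htelescope (N : ℕ) : ∑ b ∈ Finset.range N, weight (rowStep d (b + B) q) =
      weight q * tailProb q B - weight q * tailProb q (N + B) := by
    simp only [weight_rowStep _ hq, add_right_comm _ B 1]
    simpa using Finset.sum_range_sub' (fun b => weight q * tailProb q (b + B)) N
  simp only [htelescope]
  simpa using (((tendsto_add_atTop_iff_nat B).2 (tendsto_tailProb (hq 0))).const_mul
    (weight q)).const_sub (weight q * tailProb q B)

theorem sum_range_weight_rowStep (hq : ∀ i, 0 < q i) (B : ℕ) :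
    ∑ b ∈ Finset.range B, weight (rowStep d b q) = weight q * (1 - tailProb q B) := by
  have hzero : tailProb q 0 = 1 := by simp [tailProb, (hq _).ne']
  simp only [weight_rowStep _ hq, Finset.sum_range_sub', hzero]
  ring

theorem tsum_le_of_le_weight_rowStep (hq : ∀ i, 0 < q i) {c : ℕ → ENNReal} {η H p : ℝ} {B : ℕ}
    (hη : 0 ≤ η) (hηH : η ≤ H) (hp : tailProb q B ≤ p)
    (hsmall : ∀ b < B, c b ≤ ENNReal.ofReal (η * weight (rowStep d b q)))
    (hall : ∀ b, c b ≤ ENNReal.ofReal (H * weight (rowStep d b q))) :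
    ∑' b, c b ≤ ENNReal.ofReal (((1 - p) * η + p * H) * weight q) := by
  have hH : 0 ≤ H := hη.trans hηH
  have hw (b : ℕ) : 0 ≤ weight (rowStep d b q) := (weight_pos (rowStep_pos b hq)).le
  have hhead : ∑ b ∈ Finset.range B, c b ≤
      ENNReal.ofReal (η * (weight q * (1 - tailProb q B))) := by
    rw [← sum_range_weight_rowStep hq, Finset.mul_sum,
      ENNReal.ofReal_sum_of_nonneg fun b _ => mul_nonneg hη (hw b)]
    exact Finset.sum_le_sum fun b hb => hsmall b (Finset.mem_range.1 hb)
  have htail : ∑' b, c (b + B) ≤ ENNReal.ofReal (H * (weight q * tailProb q B)) := by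
    have hsum := (hasSum_weight_rowStep_add hq B).mul_left H
    rw [← hsum.tsum_eq, ENNReal.ofReal_tsum_of_nonneg (fun b => mul_nonneg hH (hw _)) hsum.summable]
    exact ENNReal.tsum_le_tsum fun b => hall (b + B)
  rw [← ENNReal.summable.sum_add_tsum_nat_add' (k := B)]
  refine (add_le_add hhead htail).trans ?_
  rw [← sum_range_weight_rowStep hq, ← ENNReal.ofReal_add
    (mul_nonneg hη (Finset.sum_nonneg fun b _ => hw b))
    (mul_nonneg hH ((hasSum_weight_rowStep_add hq B).nonneg fun b => hw _))]
  refine ENNReal.ofReal_le_ofReal ?_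
  rw [sum_range_weight_rowStep hq]
  have hgap := mul_le_mul_of_nonneg_left hp (mul_nonneg (sub_nonneg.2 hηH) (weight_pos hq).le)
  linarith

end DigitDistribution

section ConeBound

/-- For every row in `S`, the cone over `X` takes up at most the proportion `(d + 2)! * η` of the
simplex which the row cuts out of the positive orthant. -/
def ConeBound {d : ℕ} (X : Set (Fin (d + 1) → ℝ)) (S : Set (Fin (d + 2) → ℝ)) (η : ℝ) : Prop :=
  ∀ q ∈ S, coneVol X q ≤ ENNReal.ofReal (η * weight q)

/-- The positive monotone rows, a class which is preserved by `rowStep d b`. -/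
def admissibleRows (d : ℕ) : Set (Fin (d + 2) → ℝ) := {q | (∀ i, 0 < q i) ∧ Monotone q}

/-- The admissible rows whose last, and so largest, entry is at most `K` times the `i`-th. -/
def comparableRows {d : ℕ} (K : ℝ) (i : Fin (d + 2)) : Set (Fin (d + 2) → ℝ) :=
  {q | q ∈ admissibleRows d ∧ q (Fin.last (d + 1)) ≤ K * q i}

variable {d : ℕ} {X Y Z : Set (Fin (d + 1) → ℝ)} {S S' : Set (Fin (d + 2) → ℝ)}
  {q : Fin (d + 2) → ℝ} {η H p : ℝ}

theorem rowStep_mem_admissibleRows (b : ℕ) (hq : q ∈ admissibleRows d) :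
    rowStep d b q ∈ admissibleRows d :=
  ⟨rowStep_pos b hq.1, monotone_rowStep b (hq.1 0).le hq.2⟩

theorem isClosed_setOf_coneBound (X : Set (Fin (d + 1) → ℝ)) (S : Set (Fin (d + 2) → ℝ)) :
    IsClosed {η | ConeBound X S η} := by
  simp only [ConeBound, ofPred_forall]
  exact isClosed_biInter fun q _ => isClosed_le continuous_const
    (ENNReal.continuous_ofReal.comp (continuous_id.mul continuous_const))

theorem coneBound_one (hX : X ⊆ simplex d) : ConeBound X (admissibleRows d) 1 :=
  fun q hq => by simpa using coneVol_le_weight hX hq.1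

theorem ConeBound.of_children (hX : X ⊆ digitDomain d) (hS : S ⊆ admissibleRows d)
    (hη : 0 ≤ η) (hηH : η ≤ H) (hXZ : MapsTo (triangleMap d) X Z)
    (hZ : ConeBound Z (admissibleRows d) H) (hY : ConeBound Y S' η)
    (hsmall : ∀ q ∈ S, ∃ B, tailProb q B ≤ p ∧ ∀ b < B, rowStep d b q ∈ S' ∧
      MapsTo (triangleMap d) (X ∩ subsimplex d b) Y) :
    ConeBound X S ((1 - p) * η + p * H) := by
  intro q hq
  obtain ⟨B, hp, hB⟩ := hsmall q hq
  refine (coneVol_le_tsum hX q).trans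
    (tsum_le_of_le_weight_rowStep (hS hq).1 hη hηH hp (fun b hb => ?_) fun b => ?_)
  · exact (coneVol_mono (hB b hb).2.image_subset _).trans (hY _ (hB b hb).1)
  · exact (coneVol_mono (hXZ.mono_left inter_subset_left).image_subset _).trans
      (hZ _ (rowStep_mem_admissibleRows b (hS hq)))

end ConeBound

section ZeroRuns

/-- The points whose first `L` digits vanish. -/
def zeroPrefix (d L : ℕ) : Set (Fin (d + 1) → ℝ) :=
  {x | ∀ i < L, digit d ((triangleMap d)^[i] x) = 0}

/-- The points all of whose digits are defined, with no `L` consecutive digits vanishing. -/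
def noZeroRun (d L : ℕ) : Set (Fin (d + 1) → ℝ) :=
  {x | ∀ k, (triangleMap d)^[k] x ∈ digitDomain d \ zeroPrefix d L}

variable {d L : ℕ} {H K : ℝ}

theorem noZeroRun_subset_digitDomain : noZeroRun d L ⊆ digitDomain d := fun _ hx => (hx 0).1

theorem noZeroRun_diff_zeroPrefix : noZeroRun d L \ zeroPrefix d L = noZeroRun d L :=
  sdiff_eq_left.2 (disjoint_left.2 fun _ hx => (hx 0).2)

theorem mapsTo_triangleMap_noZeroRun :
    MapsTo (triangleMap d) (noZeroRun d L) (noZeroRun d L) :=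
  fun x hx k => Function.iterate_succ_apply (triangleMap d) k x ▸ hx (k + 1)

theorem mapsTo_triangleMap_diff_zeroPrefix (j : ℕ) :
    MapsTo (triangleMap d) ((noZeroRun d L \ zeroPrefix d (j + 1)) ∩ subsimplex d 0)
      (noZeroRun d L \ zeroPrefix d j) := by
  rintro x ⟨⟨hx, hprefix⟩, hzero⟩
  refine ⟨mapsTo_triangleMap_noZeroRun hx, fun h => hprefix fun i hi => ?_⟩
  cases i with
  | zero => exact digit_eq_of_mem_subsimplex hzero
  | succ i => exact h i (Nat.succ_lt_succ_iff.1 hi)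

theorem exists_coneBound_diff_zeroPrefix (hH : 0 < H)
    (hbound : ConeBound (noZeroRun d L) (admissibleRows d) H) (j : ℕ) (hK : 0 < K) :
    ∃ η ∈ Ico 0 H, ConeBound (noZeroRun d L \ zeroPrefix d j) (comparableRows K 0) η := by
  induction j generalizing K with
  | zero =>
    have hempty : noZeroRun d L \ zeroPrefix d 0 = ∅ := by simp [zeroPrefix]
    exact ⟨0, ⟨le_rfl, hH⟩, fun q _ => by simp [hempty, coneVol, cone]⟩
  | succ j ih =>
    obtain ⟨η, ⟨hη, hηH⟩, hY⟩ := ih (K := K + 1) (by positivity)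
    have hp : K / (K + 1) < 1 := (div_lt_one (by positivity)).2 (lt_add_one K)
    refine ⟨(1 - K / (K + 1)) * η + K / (K + 1) * H, ⟨?_, ?_⟩,
      .of_children (sdiff_subset.trans noZeroRun_subset_digitDomain) (fun q hq => hq.1) hη hηH.le
        (mapsTo_triangleMap_noZeroRun.mono_left sdiff_subset) hbound hY fun q hq => ⟨1, ?_, ?_⟩⟩
    · have := sub_nonneg.2 hp.le
      positivity
    · linarith [mul_lt_mul_of_pos_left hηH (sub_pos.2 hp)]
    · obtain ⟨⟨hpos, -⟩, hqK⟩ := hq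
      have hfirst := hpos 0
      have hlast := hpos (Fin.last (d + 1))
      rw [tailProb, div_le_div_iff₀ (by positivity) (by positivity)]
      push_cast
      linarith
    · rintro b hb
      obtain rfl := Nat.lt_one_iff.1 hb
      refine ⟨⟨rowStep_mem_admissibleRows 0 hq.1, ?_⟩, mapsTo_triangleMap_diff_zeroPrefix j⟩
      obtain ⟨⟨hpos, hmono⟩, hqK⟩ := hq
      have hfirst : q 0 ≤ rowStep d 0 q 0 :=
        (hmono (Fin.zero_le 1)).trans (succ_le_rowStep_castSucc 0 (hpos 0).le 0)
      have hscaled := mul_le_mul_of_nonneg_left hfirst hK.le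
      rw [rowStep_last]
      push_cast
      linarith

theorem exists_coneBound_noZeroRun (hH : 0 < H)
    (hbound : ConeBound (noZeroRun d L) (admissibleRows d) H) (i : Fin (d + 2)) (hK : 0 < K) :
    ∃ η ∈ Ico 0 H, ConeBound (noZeroRun d L) (comparableRows K i) η := by
  induction i using Fin.induction generalizing K with
  | zero => simpa only [noZeroRun_diff_zeroPrefix] using
      exists_coneBound_diff_zeroPrefix hH hbound L hK
  | succ i ih =>
    obtain ⟨η, ⟨hη, hηH⟩, hY⟩ := ih (K := 3 * K) (by positivity)
    refine ⟨(1 - 1 / 2) * η + 1 / 2 * H, ⟨by linarith, by linarith⟩,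
      .of_children noZeroRun_subset_digitDomain (fun q hq => hq.1) hη hηH.le
        mapsTo_triangleMap_noZeroRun hbound hY fun q hq =>
        ⟨⌈q (Fin.last (d + 1)) / q 0⌉₊, ?_, fun b hb =>
        ⟨⟨rowStep_mem_admissibleRows b hq.1, ?_⟩,
          mapsTo_triangleMap_noZeroRun.mono_left inter_subset_left⟩⟩⟩
    · have hfirst := hq.1.1 0
      have hlast := hq.1.1 (Fin.last (d + 1))
      have hceil := (div_le_iff₀ hfirst).1 (Nat.le_ceil (q (Fin.last (d + 1)) / q 0))
      rw [tailProb, div_le_div_iff₀ (by positivity) two_pos]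
      linarith
    · obtain ⟨⟨hpos, hmono⟩, hqK⟩ := hq
      have hdigit := (lt_div_iff₀ (hpos 0)).1 (Nat.lt_ceil.1 hb)
      have hfirst := hmono (Fin.zero_le (Fin.last (d + 1)))
      have hentry :=
        mul_le_mul_of_nonneg_left (succ_le_rowStep_castSucc b (hpos 0).le i) hK.le
      rw [rowStep_last]
      linarith

theorem exists_coneBound_lt (hH : 0 < H)
    (hbound : ConeBound (noZeroRun d L) (admissibleRows d) H) :
    ∃ η ∈ Ico 0 H, ConeBound (noZeroRun d L) (admissibleRows d) η := by
  obtain ⟨η, hη, h⟩ := exists_coneBound_noZeroRun hH hbound (Fin.last (d + 1)) one_pos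
  exact ⟨η, hη, fun q hq => h q ⟨hq, (one_mul _).ge⟩⟩

theorem coneBound_noZeroRun_zero : ConeBound (noZeroRun d L) (admissibleRows d) 0 := by
  let bounds := Ici (0 : ℝ) ∩ {η | ConeBound (noZeroRun d L) (admissibleRows d) η}
  have hbdd : BddBelow bounds := ⟨0, fun _ hη => hη.1⟩
  have hleast : sInf bounds ∈ bounds :=
    (isClosed_Ici.inter (isClosed_setOf_coneBound _ _)).csInf_mem
      ⟨1, mem_Ici.2 zero_le_one, coneBound_one fun _ hx => (noZeroRun_subset_digitDomain hx).1⟩ hbdd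
  rcases (mem_Ici.1 hleast.1).eq_or_lt with hzero | hpos
  · exact hzero ▸ hleast.2
  · obtain ⟨η, ⟨hη, hlt⟩, hbound⟩ := exists_coneBound_lt hpos hleast.2
    exact absurd (csInf_le hbdd ⟨hη, hbound⟩) (not_le.2 hlt)

theorem volume_cone_noZeroRun : volume (cone (noZeroRun d L)) = 0 :=
  volume_cone_eq_zero_of_coneVol fun c hc => le_antisymm
    (by simpa using coneBound_noZeroRun_zero (d := d) (L := L) _ ⟨fun _ => hc, monotone_const⟩)
    zero_le

end ZeroRuns

section NullCones

theorem measure_eq_zero_of_homogenization {E : Type*} [NormedAddCommGroup E] [NormedSpace ℝ E]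
    [FiniteDimensional ℝ E] [MeasurableSpace E] [BorelSpace E] (μ : Measure E) [μ.IsAddHaarMeasure]
    {X : Set E} (h : volume.prod μ {p : ℝ × E | 0 < p.1 ∧ p.1⁻¹ • p.2 ∈ X} = 0) : μ X = 0 := by
  have hslice := ae_restrict_of_ae (s := Ioi 0) (Measure.measure_ae_null_of_prod_null h)
  have : NeBot (ae (volume.restrict (Ioi (0 : ℝ)))) := by
    rw [ae_neBot, Ne, Measure.restrict_eq_zero]
    simp
  obtain ⟨t, ht, hnull⟩ := (ae_restrict_mem measurableSet_Ioi |>.and hslice).exists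
  have ht' : t ≠ 0 := (mem_Ioi.1 ht).ne'
  have hscaled : μ ((t⁻¹ • ·) ⁻¹' X) = 0 := by simpa [preimage, mem_Ioi.1 ht] using hnull
  rw [Measure.addHaar_preimage_smul _ (inv_ne_zero ht'), mul_eq_zero] at hscaled
  exact hscaled.resolve_left (by simp [ht'])

variable {d : ℕ} {X Y : Set (Fin (d + 1) → ℝ)}

theorem volume_eq_zero_of_volume_cone_eq_zero (h : volume (cone X) = 0) : volume X = 0 := by
  refine measure_eq_zero_of_homogenization volume ?_
  rw [← Measure.volume_eq_prod,
    ← (volume_preserving_piFinSuccAbove (fun _ : Fin (d + 2) => ℝ) 0).measure_preimage_equiv]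
  have hsub : MeasurableEquiv.piFinSuccAbove (fun _ : Fin (d + 2) => ℝ) 0 ⁻¹'
      {p | 0 < p.1 ∧ p.1⁻¹ • p.2 ∈ X} ⊆ consecutiveDiffs (d + 1) ⁻¹' cone X := by
    rintro z ⟨hz, hx⟩
    refine ⟨z 0, hz, _, hx, ?_⟩
    rw [barycentric, ← map_smul]
    congr 1
    ext i
    have hz' : z 0 ≠ 0 := hz.ne'
    induction i using Fin.cases with
    | zero => simp
    | succ i => exact (mul_inv_cancel_left₀ hz' _).symm
  refine measure_mono_null hsub ?_
  rw [Measure.addHaar_preimage_linearMap _ (det_consecutiveDiffs_ne_zero _), h, mul_zero]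

theorem ae_iterate_notMem (hY : volume (cone Y) = 0) :
    ∀ᵐ x : Fin (d + 1) → ℝ, ∀ k, (∀ i < k, (triangleMap d)^[i] x ∈ digitDomain d) →
      (triangleMap d)^[k] x ∉ Y := by
  let visits (k : ℕ) : Set (Fin (d + 1) → ℝ) :=
    {x | (∀ i < k, (triangleMap d)^[i] x ∈ digitDomain d) ∧ (triangleMap d)^[k] x ∈ Y}
  have hvisits (k : ℕ) : volume (cone (visits k)) = 0 := by
    induction k with
    | zero => simpa [visits] using hY
    | succ k ih =>
      exact volume_cone_eq_zero_of_mapsTo (Y := visits k) (fun x hx => hx.1 0 k.succ_pos)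
        (fun x hx => ⟨fun i hi => hx.1 (i + 1) (Nat.succ_lt_succ hi), hx.2⟩) ih
  filter_upwards [ae_all_iff.2 fun k => measure_eq_zero_iff_ae_notMem.1
    (volume_eq_zero_of_volume_cone_eq_zero (hvisits k))] with x hx k hk hmem
  exact hx k ⟨hk, hmem⟩

theorem volume_cone_simplex_diff_digitDomain :
    volume (cone (simplex d \ digitDomain d)) = 0 := by
  refine measure_mono_null (t := {u | u (Fin.last (d + 1)) = 0}) ?_
    (Measure.pi_hyperplane _ (Fin.last (d + 1)) 0)
  rintro _ ⟨c, -, x, ⟨hx, hdigit⟩, rfl⟩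
  have hlast : x (Fin.last d) = 0 :=
    le_antisymm (not_lt.1 fun hpos => hdigit ⟨hx, hpos⟩) hx.2.2
  simp [hlast]

theorem ae_iterate_mem_digitDomain : ∀ᵐ x : Fin (d + 1) → ℝ,
    x ∈ simplex d → ∀ k, (triangleMap d)^[k] x ∈ digitDomain d := by
  filter_upwards [ae_iterate_notMem (volume_cone_simplex_diff_digitDomain (d := d))] with x hx hs k
  induction k using Nat.strong_induction_on with
  | _ k ih =>
    have hmem : (triangleMap d)^[k] x ∈ simplex d := by
      cases k with
      | zero => exact hs
      | succ k =>
        rw [Function.iterate_succ_apply']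
        exact triangleMap_mem_simplex (mem_subsimplex_digit (ih k k.lt_succ_self))
    exact not_not.1 fun hdigit => hx k ih ⟨hmem, hdigit⟩

theorem ae_frequently_mem_zeroPrefix (L : ℕ) : ∀ᵐ x : Fin (d + 1) → ℝ,
    (∀ k, (triangleMap d)^[k] x ∈ digitDomain d) →
      ∃ᶠ j in atTop, (triangleMap d)^[j] x ∈ zeroPrefix d L := by
  filter_upwards [ae_iterate_notMem (volume_cone_noZeroRun (d := d) (L := L))] with x hx hdigit
  by_contra hrare
  obtain ⟨k, hk⟩ := eventually_atTop.1 (not_frequently.1 hrare)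
  refine hx k (fun i _ => hdigit i) fun j => ?_
  rw [← Function.iterate_add_apply]
  exact ⟨hdigit _, hk _ (Nat.le_add_left _ _)⟩

end NullCones

end TriangleMap

theorem mainTheorem3 (d : ℕ) :
    ∀ᵐ x ∂(volume : Measure (Fin (d + 1) → ℝ)),
      x ∈ TriangleMap.simplex d → TriangleMap.WeaklyConvergesAt d x := by
  filter_upwards [TriangleMap.ae_iterate_mem_digitDomain,
    TriangleMap.ae_frequently_mem_zeroPrefix (TriangleMap.mixingLength d)] with x hdigit hzero hx
  refine TriangleMap.weaklyConvergesAt_of_frequently_zero_run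
    (b := fun k => TriangleMap.digit d ((TriangleMap.triangleMap d)^[k] x))
    (fun k => TriangleMap.mem_subsimplex_digit (hdigit hx k)) ?_
  refine (hzero (hdigit hx)).mono fun j hj i hi => ?_
  rw [add_comm j i, Function.iterate_add_apply]
  exact hj i hi
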